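/- Let $M$ and $N$ be complete smooth Riemannian manifolds with $\dim M \geq 2$. For a map $u : M \to N$ and a set $S \subseteq M$, let $\mathrm{Lip}(u, S) \in [0, \infty]$ denote the least constant $K$ such that $\mathrm{dist}_N(u(y), u(z)) \leq K\, \mathrm{dist}_M(y, z)$ for all $y, z \in S$, and let $$Lu(x) := \limsup_{r \to 0^+} \mathrm{Lip}(u, B(x, r))$$ be the local Lipschitz constant of $u$ at $x \in M$, where $B(x,r)$ is the ball of radius $r$ centered at $x$. Let $u : M \to N$ be a Lipschitz map, and let $\psi : M \to [0, \infty)$ be an upper-semicontinuous function. If $Lu \leq \psi$ almost everywhere on $M$ (that is, outside a set of measure zero), then $Lu \leq \psi$ everywhere on $M$. -/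

import Mathlib

open Bundle Set Filter Topology MeasureTheory
open scoped NNReal ENNReal Manifold ContDiff

/-- The Lipschitz constant `Lip(u, S)`: the least `K` such that `u` is `K`-Lipschitz on `S`
(it is `∞` if there is no such `K`). -/
noncomputable def lipConst {X Y : Type*} [PseudoEMetricSpace X] [PseudoEMetricSpace Y]
    (u : X → Y) (S : Set X) : ℝ≥0∞ :=
  ⨅ (K : ℝ≥0) (_ : LipschitzOnWith K u S), (K : ℝ≥0∞)

/-- The local Lipschitz constant `Lu(x) = limsup_{r → 0+} Lip(u, B(x, r))`. -/
noncomputable def localLip {X Y : Type*} [PseudoEMetricSpace X] [PseudoEMetricSpace Y]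
    (u : X → Y) (x : X) : ℝ≥0∞ :=
  limsup (fun r : ℝ≥0∞ => lipConst u (Metric.eball x r)) (𝓝[>] 0)

/-- A subset of a smooth `m`-dimensional manifold has measure zero if its image in every smooth
chart is a Lebesgue null set of `ℝᵐ`. The Riemannian volume of a smooth Riemannian metric has a
positive smooth density with respect to Lebesgue measure in each chart, so on a second countable
manifold these are the null sets of the Riemannian volume. -/
def IsNullOnManifold {m : ℕ} {M : Type*} [TopologicalSpace M]
    [ChartedSpace (EuclideanSpace ℝ (Fin m)) M] (A : Set M) : Prop :=
  ∀ φ ∈ IsManifold.maximalAtlas (𝓡 m) ∞ M, volume (φ '' (A ∩ φ.source)) = 0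

/-! The exceptional null set is avoided by Fubini: almost every small translate of a segment in a
chart meets it only in a null set of times. Along such a segment the map is a Lipschitz curve whose
speed is controlled almost everywhere, so integrating the speed bounds the displacement of the
endpoints; continuity removes the translation (`edist_le_of_ae_eventually_edist_le_enorm`).

To keep the constant sharp, chart displacements are measured in the norm of the tangent space at
`x`. By continuity of the metric this norm agrees with the Riemannian distance near `x` up to a
factor `r > 1` in each direction, and `r → 1` at the end. Upper semicontinuity makes `ψ x + ε` a
strict almost everywhere bound near `x`. -/

/-- A Lipschitz curve whose pointwise Lipschitz constant is almost everywhere at most `C` moves by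
at most `C` in unit time. -/
lemma edist_le_of_ae_eventually_edist_le {Y : Type*} [PseudoEMetricSpace Y] {f : ℝ → Y}
    {K C : ℝ≥0} (hf : LipschitzOnWith K f (Icc 0 1))
    (hC : ∀ᵐ t : ℝ, t ∈ Icc (0 : ℝ) 1 → ∀ᶠ s in 𝓝 t, edist (f s) (f t) ≤ C * edist s t) :
    edist (f 0) (f 1) ≤ C := by
  have hfin : ∀ t ∈ Icc (0 : ℝ) 1, edist (f 0) (f t) ≠ ⊤ := fun t ht =>
    ne_top_of_le_ne_top (by finiteness) (hf ⟨le_rfl, zero_le_one⟩ ht)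
  have key : ∀ (D : ℝ≥0) (s : ℝ) (_ : s ∈ Icc (0 : ℝ) 1) (t : ℝ) (_ : t ∈ Icc (0 : ℝ) 1),
      edist (f s) (f t) ≤ D * edist s t →
      |(edist (f 0) (f s)).toReal - (edist (f 0) (f t)).toReal| ≤ D * |s - t| := by
    intro D s hs t ht h
    have hst : (edist (f s) (f t)).toReal ≤ D * |s - t| := by
      have := ENNReal.toReal_mono (by finiteness) h
      simpa [edist_dist, Real.dist_eq] using this
    have hfst : edist (f s) (f t) ≠ ⊤ := ne_top_of_le_ne_top (by finiteness) h
    have h1 := ENNReal.toReal_mono (ENNReal.add_ne_top.2 ⟨hfin t ht, hfst⟩)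
      ((edist_triangle (f 0) (f t) (f s)).trans_eq (by rw [edist_comm (f t)]))
    have h2 := ENNReal.toReal_mono (ENNReal.add_ne_top.2 ⟨hfin s hs, hfst⟩)
      (edist_triangle (f 0) (f s) (f t))
    rw [ENNReal.toReal_add (hfin t ht) hfst] at h1
    rw [ENNReal.toReal_add (hfin s hs) hfst] at h2
    rw [abs_le]
    constructor <;> linarith
  -- The target is only a metric space, so the curve is replaced by its distance to the starting
  -- point, a real Lipschitz function obeying the fundamental theorem of calculus.
  set g : ℝ → ℝ := fun t => (edist (f 0) (f t)).toReal with hg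
  have hgL : LipschitzOnWith K g (uIcc 0 1) := by
    rw [uIcc_of_le zero_le_one]
    refine LipschitzOnWith.of_dist_le_mul fun s hs t ht => ?_
    exact key K s hs t ht (hf hs ht)
  have hint := hgL.absolutelyContinuousOnInterval.integral_deriv_eq_sub
  have hbound : ∀ᵐ t : ℝ, t ∈ uIoc (0 : ℝ) 1 → ‖deriv g t‖ ≤ C := by
    have h1 : ∀ᵐ t : ℝ, t ≠ 1 := by simp [ae_iff]
    filter_upwards [hC, h1] with t ht ht1 hmem
    rw [uIoc_of_le zero_le_one] at hmem
    have hIoo : t ∈ Ioo (0 : ℝ) 1 := ⟨hmem.1, lt_of_le_of_ne hmem.2 ht1⟩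
    refine norm_deriv_le_of_lip' C.2 ?_
    filter_upwards [ht ⟨hmem.1.le, hmem.2⟩, Icc_mem_nhds hIoo.1 hIoo.2] with s hs hs'
    exact key C s hs' t ⟨hmem.1.le, hmem.2⟩ hs
  have hle := intervalIntegral.norm_integral_le_of_norm_le_const_ae hbound
  rw [hint] at hle
  have h0 : g 0 = 0 := by simp [hg]
  rw [h0] at hle
  simp only [sub_zero, abs_one, mul_one, Real.norm_eq_abs] at hle
  rw [← ENNReal.ofReal_toReal (hfin 1 (by simp))]
  refine (ENNReal.ofReal_le_ofReal ((le_abs_self _).trans hle)).trans_eq ?_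
  simp

/-- Almost every translate of a given line segment meets a null set in a null set of parameters. -/
lemma ae_ae_add_lineMap_notMem {E : Type*} [NormedAddCommGroup E] [NormedSpace ℝ E]
    [FiniteDimensional ℝ E] [MeasurableSpace E] [BorelSpace E] (μ : Measure E)
    [μ.IsAddHaarMeasure] {Z : Set E} (hZ : μ Z = 0) (p q : E) :
    ∀ᵐ h ∂μ, ∀ᵐ t : ℝ, h + AffineMap.lineMap p q t ∉ Z := by
  have : ProperSpace E := FiniteDimensional.proper_real E
  set Z' := toMeasurable μ Z
  have hZ' : MeasurableSet Z' := measurableSet_toMeasurable μ Z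
  have hcont : Continuous fun a : ℝ × E => a.2 + AffineMap.lineMap p q a.1 := by
    simp only [AffineMap.lineMap_apply]
    fun_prop
  have hmeas : MeasurableSet {a : ℝ × E | a.2 + AffineMap.lineMap p q a.1 ∉ Z'} :=
    hcont.measurable hZ'.compl
  have h1 : ∀ᵐ t : ℝ, ∀ᵐ h ∂μ, h + AffineMap.lineMap p q t ∉ Z' := by
    refine ae_of_all _ fun t => ?_
    have h2 : ∀ᵐ x ∂μ, x ∉ Z' := by
      rw [ae_iff]; simpa [Z', measure_toMeasurable] using hZ
    exact (measurePreserving_add_right μ (AffineMap.lineMap p q t)).quasiMeasurePreserving.ae h2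
  have h3 := (Measure.ae_ae_comm (p := fun (t : ℝ) (h : E) =>
    h + AffineMap.lineMap p q t ∉ Z') hmeas).1 h1
  filter_upwards [h3] with h hh
  filter_upwards [hh] with t ht hZt
  exact ht (subset_toMeasurable μ Z hZt)

/-- On a convex open set, an almost everywhere local Lipschitz bound for a Lipschitz map, measured
with respect to a linear image of the displacement, is a global bound. -/
theorem edist_le_of_ae_eventually_edist_le_enorm {E F Y : Type*} [NormedAddCommGroup E]
    [NormedSpace ℝ E] [FiniteDimensional ℝ E] [MeasurableSpace E] [BorelSpace E] (μ : Measure E)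
    [μ.IsAddHaarMeasure] [SeminormedAddCommGroup F] [NormedSpace ℝ F] [PseudoEMetricSpace Y]
    (L : E →ₗ[ℝ] F) {v : E → Y} {V Z : Set E} (hVo : IsOpen V) (hVc : Convex ℝ V) {K C : ℝ≥0}
    (hK : LipschitzOnWith K v V) (hZ : μ Z = 0)
    (hC : ∀ x ∈ V, x ∉ Z → ∀ᶠ y in 𝓝 x, edist (v y) (v x) ≤ C * ‖L (y - x)‖ₑ)
    {p q : E} (hp : p ∈ V) (hq : q ∈ V) :
    edist (v p) (v q) ≤ C * ‖L (q - p)‖ₑ := by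
  set D : Set E := {h | ∀ᵐ t : ℝ, h + AffineMap.lineMap p q t ∉ Z}
  -- A set of full measure is dense, so admissible translations `h` tend to `0`; the estimate is
  -- proved for them and passes to the limit.
  have hD : Dense D := Measure.dense_of_ae (ae_ae_add_lineMap_notMem μ hZ p q)
  have hne : (𝓝[D] (0 : E)).NeBot := mem_closure_iff_nhdsWithin_neBot.1 (hD 0)
  have hpt : Tendsto (fun h : E => h + p) (𝓝 0) (𝓝 p) := by
    simpa using (continuous_add_const p).tendsto 0
  have hqt : Tendsto (fun h : E => h + q) (𝓝 0) (𝓝 q) := by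
    simpa using (continuous_add_const q).tendsto 0
  have hvp : Tendsto (fun h => v (h + p)) (𝓝[D] 0) (𝓝 (v p)) :=
    ((hK.continuousOn.continuousAt (hVo.mem_nhds hp)).tendsto.comp hpt).mono_left nhdsWithin_le_nhds
  have hvq : Tendsto (fun h => v (h + q)) (𝓝[D] 0) (𝓝 (v q)) :=
    ((hK.continuousOn.continuousAt (hVo.mem_nhds hq)).tendsto.comp hqt).mono_left nhdsWithin_le_nhds
  refine le_of_tendsto (hvp.edist hvq) ?_
  filter_upwards [self_mem_nhdsWithin, nhdsWithin_le_nhds (hpt (hVo.mem_nhds hp)),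
    nhdsWithin_le_nhds (hqt (hVo.mem_nhds hq))] with h hh hhp hhq
  set f : ℝ → E := fun t => h + AffineMap.lineMap p q t with hf
  have hdiff : ∀ s t, f s - f t = (s - t) • (q - p) := by
    intro s t
    simp only [hf, AffineMap.lineMap_apply, vsub_eq_sub, vadd_eq_add]
    module
  have hfc : Continuous f := by
    simp only [hf, AffineMap.lineMap_apply]
    fun_prop
  have hfV : ∀ t ∈ Icc (0 : ℝ) 1, f t ∈ V := by
    intro t ht
    have : f t = AffineMap.lineMap (h + p) (h + q) t := by
      simp only [hf, AffineMap.lineMap_apply, vsub_eq_sub, vadd_eq_add]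
      module
    rw [this]
    exact hVc.lineMap_mem hhp hhq ht
  have hen : ∀ s t : ℝ, ‖s - t‖ₑ = edist s t := fun s t => (edist_eq_enorm_sub s t).symm
  have hres : edist ((v ∘ f) 0) ((v ∘ f) 1) ≤ ((C * ‖L (q - p)‖₊ : ℝ≥0) : ℝ≥0∞) := by
    refine edist_le_of_ae_eventually_edist_le (K := K * ‖q - p‖₊) ?_ ?_
    · intro s hs t ht
      refine (hK (hfV s hs) (hfV t ht)).trans_eq ?_
      rw [edist_eq_enorm_sub, hdiff, enorm_smul, hen, ENNReal.coe_mul, mul_assoc, mul_comm (edist s t)]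
      rfl
    · filter_upwards [hh] with t ht htI
      have := hC (f t) (hfV t htI) ht
      filter_upwards [hfc.continuousAt.eventually this] with s hs
      refine hs.trans_eq ?_
      rw [hdiff, map_smul, enorm_smul, hen, ENNReal.coe_mul, mul_assoc, mul_comm (edist s t)]
      rfl
  simpa [hf, enorm] using hres

/-! ### Local Lipschitz constants and Lipschitz neighbourhoods -/

section LocalLip

variable {X Y : Type*} [PseudoEMetricSpace X] [PseudoEMetricSpace Y] {u : X → Y} {x : X}

lemma exists_lipschitzOnWith_eball_of_localLip_lt {c : ℝ≥0} (h : localLip u x < c) :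
    ∃ r > 0, LipschitzOnWith c u (Metric.eball x r) := by
  have h1 := (eventually_lt_of_limsup_lt h).and
    (self_mem_nhdsWithin : Ioi (0 : ℝ≥0∞) ∈ 𝓝[>] 0)
  obtain ⟨r, hr, hr0⟩ := h1.exists
  refine ⟨r, hr0, ?_⟩
  simp only [lipConst, iInf_lt_iff] at hr
  obtain ⟨K, hK, hKc⟩ := hr
  exact hK.weaken (by exact_mod_cast hKc.le)

lemma localLip_le_of_lipschitzOnWith_nhds {c : ℝ≥0} {s : Set X} (hs : s ∈ 𝓝 x)
    (h : LipschitzOnWith c u s) : localLip u x ≤ c := by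
  obtain ⟨r, hr, hrs⟩ := EMetric.mem_nhds_iff.1 hs
  refine limsup_le_of_le (by isBoundedDefault) ?_
  filter_upwards [Ioo_mem_nhdsGT hr] with r' hr'
  exact iInf₂_le c (h.mono ((Metric.eball_subset_eball hr'.2.le).trans hrs))

end LocalLip

/-! ### Almost isometric charts -/

section Chart

variable {E : Type*} [NormedAddCommGroup E] [NormedSpace ℝ E]
  {H : Type*} [TopologicalSpace H] {I : ModelWithCorners ℝ E H}
  {M : Type*} [PseudoEMetricSpace M] [ChartedSpace H M] [IsManifold I 1 M]

lemma mfderivWithin_symm_extChartAt_lineMap [I.Boundaryless] (x : M) {p q : E} {t : ℝ}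
    (ht : t ∈ Icc (0 : ℝ) 1) (hp : AffineMap.lineMap p q t ∈ (extChartAt I x).target) :
    mfderiv[Icc 0 1] ((extChartAt I x).symm ∘ AffineMap.lineMap (k := ℝ) p q) t (1 : ℝ) =
      (trivializationAt E (TangentSpace I : M → Type _) x).symmL ℝ
        ((extChartAt I x).symm (AffineMap.lineMap p q t)) (q - p) := by
  have hη : HasDerivWithinAt (AffineMap.lineMap (k := ℝ) p q) (q - p) (Icc 0 1) t :=
    AffineMap.hasDerivWithinAt_lineMap
  have huniq : UniqueMDiffWithinAt 𝓘(ℝ, ℝ) (Icc (0 : ℝ) 1) t := by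
    rw [uniqueMDiffWithinAt_iff_uniqueDiffWithinAt]
    exact uniqueDiffOn_Icc zero_lt_one t ht
  rw [mfderivWithin_comp (I' := 𝓘(ℝ, E)) (u := range I) t
    (mdifferentiableWithinAt_extChartAt_symm hp) hη.differentiableWithinAt.mdifferentiableWithinAt
    (by simp [I.range_eq_univ]) huniq]
  have hsrc : (extChartAt I x).symm (AffineMap.lineMap p q t) ∈ (chartAt H x).source := by
    simpa using (extChartAt I x).map_target hp
  rw [TangentBundle.symmL_trivializationAt hsrc, (extChartAt I x).right_inv hp]
  rw [mfderivWithin_eq_fderivWithin, hη.hasFDerivWithinAt.fderivWithin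
    (uniqueDiffOn_Icc zero_lt_one t ht)]
  change mfderiv[range I] (extChartAt I x).symm _ ((1 : ℝ) • (q - p)) = _
  rw [one_smul]
  rfl

variable [RiemannianBundle (fun x : M => TangentSpace I x)]
  [IsContinuousRiemannianBundle E (fun x : M => TangentSpace I x)]

variable (I) in
/-- The identification of the model space with the tangent space at `x` given by the chart at
`x`. -/
noncomputable def chartTangent (x : M) : E →L[ℝ] TangentSpace I x :=
  (trivializationAt E (TangentSpace I : M → Type _) x).symmL ℝ x

/-- Continuity of the metric: read in the chart at `x`, the norms of nearby tangent spaces differ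
little from the norm at `x`. -/
lemma eventually_enorm_chartTangent_mfderiv_le (x : M) {r : ℝ≥0} (hr : 1 < r) :
    ∀ᶠ y in 𝓝 x, ∀ w : TangentSpace I y,
      ‖chartTangent I x (mfderiv% (extChartAt I x) y w)‖ₑ ≤ r * ‖w‖ₑ := by
  filter_upwards [eventually_norm_symmL_trivializationAt_self_comp_lt E
    (fun y : M => TangentSpace I y) x (r := r) (by exact_mod_cast hr),
    chart_source_mem_nhds H x] with y hy h'y w
  have h := (ContinuousLinearMap.le_opNorm _ w).trans
    (mul_le_mul_of_nonneg_right hy.le (norm_nonneg w))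
  rw [TangentBundle.continuousLinearMapAt_trivializationAt h'y] at h
  simp only [enorm, ← ENNReal.coe_mul]
  exact_mod_cast h

lemma eventually_enorm_mfderivWithin_symm_le_chartTangent (x : M) {r : ℝ≥0} (hr : 1 < r) :
    ∀ᶠ y in 𝓝 x, ∀ w : E,
      ‖(trivializationAt E (TangentSpace I : M → Type _) x).symmL ℝ y w‖ₑ
        ≤ r * ‖chartTangent I x w‖ₑ := by
  filter_upwards [eventually_norm_symmL_trivializationAt_comp_self_lt E
    (fun y : M => TangentSpace I y) x (r := r) (by exact_mod_cast hr)] with y hy w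
  have h := (ContinuousLinearMap.le_opNorm _ (chartTangent I x w)).trans
    (mul_le_mul_of_nonneg_right hy.le (norm_nonneg _))
  have h2 : (trivializationAt E (TangentSpace I : M → Type _) x).continuousLinearMapAt ℝ x
      (chartTangent I x w) = w :=
    Trivialization.continuousLinearMapAt_symmL _ (FiberBundle.mem_baseSet_trivializationAt' x) w
  rw [ContinuousLinearMap.comp_apply, h2] at h
  simp only [enorm, ← ENNReal.coe_mul]
  exact_mod_cast h

variable [IsRiemannianManifold I M]

/-- The straight segment in the chart is a competitor for the Riemannian distance, and its speed is
at most `r` times the norm of the displacement at `x`. -/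
lemma exists_ball_edist_symm_extChartAt_le [I.Boundaryless] (x : M) {r : ℝ≥0} (hr : 1 < r) :
    ∃ ρ > 0, Metric.ball (extChartAt I x x) ρ ⊆ (extChartAt I x).target ∧
      ∀ p ∈ Metric.ball (extChartAt I x x) ρ, ∀ q ∈ Metric.ball (extChartAt I x x) ρ,
        edist ((extChartAt I x).symm p) ((extChartAt I x).symm q)
          ≤ r * ‖chartTangent I x (q - p)‖ₑ := by
  have hcont : Tendsto (extChartAt I x).symm (𝓝 (extChartAt I x x)) (𝓝 x) := by
    simpa [ContinuousAt] using continuousAt_extChartAt_symm (I := I) x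
  have h1 := eventually_enorm_mfderivWithin_symm_le_chartTangent (I := I) x hr
  obtain ⟨ρ, hρ, hball⟩ := Metric.mem_nhds_iff.1
    (Filter.inter_mem (extChartAt_target_mem_nhds (I := I) x) (hcont.eventually h1))
  refine ⟨ρ, hρ, hball.trans inter_subset_left, fun p hp q hq => ?_⟩
  have hmem : ∀ t ∈ Icc (0 : ℝ) 1, AffineMap.lineMap p q t ∈ Metric.ball (extChartAt I x x) ρ :=
    fun t ht => (convex_ball _ _).lineMap_mem hp hq ht
  have hsmooth : CMDiff[Icc 0 1] 1 ((extChartAt I x).symm ∘ AffineMap.lineMap (k := ℝ) p q) := by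
    refine (contMDiffOn_extChartAt_symm x).comp (t := (extChartAt I x).target)
      (I' := 𝓘(ℝ, E)) ?_ fun t ht => (hball (hmem t ht)).1
    refine ContMDiff.contMDiffOn (contMDiff_iff_contDiff.2 ?_)
    exact (ContinuousAffineMap.lineMap (R := ℝ) p q).contDiff
  rw [IsRiemannianManifold.out (I := I)]
  refine (Manifold.riemannianEDist_le_pathELength hsmooth (by simp) (by simp) zero_le_one).trans ?_
  rw [Manifold.pathELength_eq_lintegral_mfderivWithin_Icc]
  calc _ ≤ ∫⁻ _ in Icc (0 : ℝ) 1, r * ‖chartTangent I x (q - p)‖ₑ := by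
        refine setLIntegral_mono' measurableSet_Icc fun t ht => ?_
        have h := (hball (hmem t ht)).2 (q - p)
        rw [← mfderivWithin_symm_extChartAt_lineMap x ht (hball (hmem t ht)).1] at h
        exact h
    _ = _ := by simp

/-- A nearly shortest curve from `y` to `z` stays near `x`, so its image in the chart is at most `r`
times as long, and the displacement is no longer than that image. -/
lemma exists_nhds_enorm_chartTangent_sub_le (x : M) {r : ℝ≥0} (hr : 1 < r) :
    ∃ s ∈ 𝓝 x, ∀ y ∈ s, ∀ z ∈ s,
      ‖chartTangent I x (extChartAt I x z - extChartAt I x y)‖ₑ ≤ r * edist y z := by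
  obtain ⟨δ, hδ, hball⟩ := EMetric.mem_nhds_iff.1
    (Filter.inter_mem (chart_source_mem_nhds H x)
      (eventually_enorm_chartTangent_mfderiv_le (I := I) x hr))
  -- A curve of length below `2δ/3` starting within `δ/3` of `x` cannot leave the `δ`-ball.
  have hδ3 : 0 < δ / 3 := ENNReal.div_pos hδ.ne' (by simp)
  refine ⟨Metric.eball x (δ / 3), Metric.eball_mem_nhds _ hδ3, fun y hy z hz => ?_⟩
  have hyz : edist y z < δ / 3 + δ / 3 :=
    (edist_triangle_right y z x).trans_lt (ENNReal.add_lt_add hy hz)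
  have hr0 : (r : ℝ≥0∞) ≠ 0 := by exact_mod_cast (zero_lt_one.trans hr).ne'
  rw [← ENNReal.div_le_iff' hr0 ENNReal.coe_ne_top]
  refine le_of_forall_gt fun R hR => ?_
  obtain ⟨R', hR', hR'R⟩ := exists_between (lt_min hR hyz)
  refine lt_of_le_of_lt ?_ (hR'R.trans_le (min_le_left _ _))
  rw [ENNReal.div_le_iff' hr0 ENNReal.coe_ne_top]
  rw [IsRiemannianManifold.out (I := I)] at hR'
  obtain ⟨γ, hγ0, hγ1, hγ, hlen, -⟩ :=
    Manifold.exists_lt_locally_constant_of_riemannianEDist_lt hR' zero_lt_one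
  have hmem : ∀ t ∈ Icc (0 : ℝ) 1, γ t ∈ Metric.eball x δ := by
    intro t ht
    have h1 : edist y (γ t) < δ / 3 + δ / 3 := by
      rw [IsRiemannianManifold.out (I := I)]
      refine (Manifold.riemannianEDist_le_pathELength hγ.contMDiffOn hγ0 rfl ht.1).trans_lt ?_
      exact (Manifold.pathELength_mono le_rfl ht.2).trans_lt
        (hlen.trans (hR'R.trans_le (min_le_right _ _)))
    calc edist (γ t) x ≤ edist y (γ t) + edist y x := edist_triangle_left _ _ _
      _ < (δ / 3 + δ / 3) + δ / 3 := ENNReal.add_lt_add h1 hy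
      _ = δ := ENNReal.add_thirds δ
  set A := chartTangent I x
  have hφγ : ContDiffOn ℝ 1 (extChartAt I x ∘ γ) (Icc 0 1) := by
    rw [← contMDiffOn_iff_contDiffOn]
    exact contMDiffOn_extChartAt.comp (I' := I) (t := (chartAt H x).source) hγ.contMDiffOn
      fun t ht => (hball (hmem t ht)).1
  have hη : ContDiffOn ℝ 1 (A ∘ extChartAt I x ∘ γ) (Icc 0 1) := A.contDiff.comp_contDiffOn hφγ
  have hle := enorm_sub_le_lintegral_derivWithin_Icc_of_contDiffOn_Icc hη zero_le_one
  simp only [Function.comp_apply, hγ0, hγ1, ← map_sub] at hle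
  refine hle.trans ?_
  calc _ ≤ ∫⁻ t in Icc (0 : ℝ) 1, r * ‖mfderiv[Icc 0 1] γ t (1 : ℝ)‖ₑ := by
        refine setLIntegral_mono' measurableSet_Icc fun t ht => ?_
        have huniq := uniqueDiffOn_Icc (zero_lt_one (α := ℝ)) t ht
        have hd : derivWithin (A ∘ extChartAt I x ∘ γ) (Icc 0 1) t =
            A (mfderiv% (extChartAt I x) (γ t) (mfderiv[Icc 0 1] γ t (1 : ℝ))) := by
          have h1 := ((hφγ.differentiableOn one_ne_zero) t ht).hasFDerivWithinAt
          have h2 := (A.hasFDerivAt.comp_hasFDerivWithinAt t h1).hasDerivWithinAt.derivWithin huniq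
          rw [h2, ← mfderivWithin_eq_fderivWithin, mfderiv_comp_mfderivWithin (I' := I) t
            (mdifferentiableAt_extChartAt (hball (hmem t ht)).1)
            ((hγ.mdifferentiable one_ne_zero) t).mdifferentiableWithinAt
            (uniqueMDiffWithinAt_iff_uniqueDiffWithinAt.2 huniq)]
          rfl
        rw [hd]
        exact (hball (hmem t ht)).2 _
    _ = r * Manifold.pathELength I γ 0 1 := by
        rw [lintegral_const_mul' _ _ ENNReal.coe_ne_top,
          Manifold.pathELength_eq_lintegral_mfderivWithin_Icc]
        rfl
    _ ≤ r * R' := by gcongr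

end Chart

/-- On a Riemannian manifold, a strict bound for the local Lipschitz constant of a Lipschitz map
which holds almost everywhere near a point gives a weak bound at that point. -/
theorem localLip_le_of_eventually_ae_lt {m : ℕ} {M Y : Type*} [PseudoEMetricSpace M]
    [ChartedSpace (EuclideanSpace ℝ (Fin m)) M] [IsManifold (𝓡 m) ∞ M]
    [RiemannianBundle (fun x : M => TangentSpace (𝓡 m) x)]
    [IsContinuousRiemannianBundle (EuclideanSpace ℝ (Fin m))
      (fun x : M => TangentSpace (𝓡 m) x)]
    [IsRiemannianManifold (𝓡 m) M] [PseudoEMetricSpace Y] {u : M → Y} {K : ℝ≥0}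
    (hu : LipschitzWith K u) {Z : Set M} (hZ : IsNullOnManifold (m := m) Z) {x : M} {c : ℝ≥0}
    (hc : ∀ᶠ y in 𝓝 x, y ∉ Z → localLip u y < c) : localLip u x ≤ c := by
  have : IsManifold (𝓡 m) 1 M := IsManifold.of_le (n := ∞) (by simp)
  have main : ∀ r : ℝ≥0, 1 < r → localLip u x ≤ ((c * r * r : ℝ≥0) : ℝ≥0∞) := by
    intro r hr
    set φ := extChartAt (𝓡 m) x with hφ
    set A := chartTangent (𝓡 m) x
    obtain ⟨ρ₀, hρ₀, hsub₀, hdist⟩ := exists_ball_edist_symm_extChartAt_le (I := 𝓡 m) x hr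
    obtain ⟨s, hs, hsA⟩ := exists_nhds_enorm_chartTangent_sub_le (I := 𝓡 m) x hr
    have hcont : Tendsto φ.symm (𝓝 (φ x)) (𝓝 x) := by
      have h : ContinuousAt φ.symm (φ x) := continuousAt_extChartAt_symm x
      rwa [ContinuousAt, extChartAt_to_inv] at h
    obtain ⟨ρ, hρ, hball⟩ := Metric.mem_nhds_iff.1
      (Filter.inter_mem (Metric.ball_mem_nhds (φ x) hρ₀) (hcont.eventually hc))
    set V := Metric.ball (φ x) ρ
    -- The size of this constant is immaterial; it only gives continuity and absolute continuity
    -- along segments.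
    have hK : LipschitzOnWith (K * r * ‖A‖₊) (u ∘ φ.symm) V := by
      intro p hp q hq
      calc edist (u (φ.symm p)) (u (φ.symm q)) ≤ K * edist (φ.symm p) (φ.symm q) := hu _ _
        _ ≤ K * (r * ‖A (q - p)‖ₑ) := by
            gcongr; exact hdist p (hball hp).1 q (hball hq).1
        _ ≤ K * (r * (‖A‖ₑ * ‖q - p‖ₑ)) := by
            gcongr; exact A.le_opENorm _
        _ = _ := by
            rw [edist_comm, edist_eq_enorm_sub]
            simp only [ENNReal.coe_mul, mul_assoc]
            rfl
    have hnull := hZ _ (IsManifold.chart_mem_maximalAtlas (I := 𝓡 m) (n := ∞) x)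
    have hV : ∀ p ∈ V, ∀ q ∈ V,
        edist (u (φ.symm p)) (u (φ.symm q)) ≤ ((c * r : ℝ≥0) : ℝ≥0∞) * ‖A (q - p)‖ₑ := by
      intro p hp q hq
      refine edist_le_of_ae_eventually_edist_le_enorm (v := u ∘ φ.symm) volume A.toLinearMap
        Metric.isOpen_ball (convex_ball _ _) hK hnull ?_ hp hq
      intro p hp hpZ
      have hpt := hsub₀ (hball hp).1
      have hgood : φ.symm p ∉ Z := by
        refine fun hmem => hpZ ⟨φ.symm p, ⟨hmem, ?_⟩, ?_⟩
        · simpa [hφ] using φ.map_target hpt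
        · simpa [hφ] using φ.right_inv hpt
      obtain ⟨δ, hδ, hLip⟩ := exists_lipschitzOnWith_eball_of_localLip_lt ((hball hp).2 hgood)
      have hcp : ContinuousAt φ.symm p := continuousAt_extChartAt_symm'' hpt
      filter_upwards [hcp.eventually (Metric.eball_mem_nhds _ hδ),
        Metric.isOpen_ball.mem_nhds hp] with q hq hqV
      rw [edist_comm, ENNReal.coe_mul, mul_assoc]
      refine (hLip (Metric.mem_eball_self hδ) hq).trans ?_
      gcongr
      exact hdist p (hball hp).1 q (hball hqV).1
    refine localLip_le_of_lipschitzOnWith_nhds (s := s ∩ (φ.source ∩ φ ⁻¹' V)) ?_ ?_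
    · refine Filter.inter_mem hs (Filter.inter_mem (extChartAt_source_mem_nhds x) ?_)
      exact (continuousAt_extChartAt x).preimage_mem_nhds (Metric.ball_mem_nhds _ hρ)
    · rintro y ⟨hys, hyφ, hyV⟩ z ⟨hzs, hzφ, hzV⟩
      have h := hV _ hyV _ hzV
      rw [φ.left_inv hyφ, φ.left_inv hzφ] at h
      refine h.trans ?_
      -- One factor `r` came from leaving the chart (in `hV`); the second comes from entering it.
      rw [ENNReal.coe_mul (c * r), mul_assoc]
      gcongr
      exact hsA y hys z hzs
  have hlim : Tendsto (fun r : ℝ≥0 => ((c * r * r : ℝ≥0) : ℝ≥0∞)) (𝓝[>] 1) (𝓝 c) := by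
    rw [ENNReal.tendsto_coe]
    have : Continuous fun r : ℝ≥0 => c * r * r := by fun_prop
    simpa using this.continuousAt.continuousWithinAt (x := 1) (s := Ioi 1) |>.tendsto
  refine ge_of_tendsto hlim ?_
  filter_upwards [self_mem_nhdsWithin] with r hr using main r hr

theorem mainTheorem3 {m n : ℕ} (hm : 2 ≤ m)
    {M : Type*} [EMetricSpace M] [ChartedSpace (EuclideanSpace ℝ (Fin m)) M]
    [IsManifold (𝓡 m) ∞ M]
    [RiemannianBundle (fun x : M => TangentSpace (𝓡 m) x)]
    [IsContMDiffRiemannianBundle (𝓡 m) ∞ (EuclideanSpace ℝ (Fin m))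
      (fun x : M => TangentSpace (𝓡 m) x)]
    [IsRiemannianManifold (𝓡 m) M] [CompleteSpace M]
    {N : Type*} [EMetricSpace N] [ChartedSpace (EuclideanSpace ℝ (Fin n)) N]
    [IsManifold (𝓡 n) ∞ N]
    [RiemannianBundle (fun y : N => TangentSpace (𝓡 n) y)]
    [IsContMDiffRiemannianBundle (𝓡 n) ∞ (EuclideanSpace ℝ (Fin n))
      (fun y : N => TangentSpace (𝓡 n) y)]
    [IsRiemannianManifold (𝓡 n) N] [CompleteSpace N]
    (u : M → N) (hu : ∃ K : ℝ≥0, LipschitzWith K u)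
    (ψ : M → ℝ≥0) (hψ : UpperSemicontinuous ψ)
    (hae : IsNullOnManifold (m := m) {x : M | ¬ localLip u x ≤ (ψ x : ℝ≥0∞)}) :
    ∀ x : M, localLip u x ≤ (ψ x : ℝ≥0∞) := by
  have : IsContinuousRiemannianBundle (EuclideanSpace ℝ (Fin m))
      (fun x : M => TangentSpace (𝓡 m) x) := by
    obtain ⟨g, hg, hinner⟩ := IsContMDiffRiemannianBundle.exists_contMDiff (IB := 𝓡 m) (n := ∞)
      (F := EuclideanSpace ℝ (Fin m)) (E := fun x : M => TangentSpace (𝓡 m) x)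
    exact ⟨g, hg.continuous, hinner⟩
  intro x
  obtain ⟨K, hK⟩ := hu
  refine ENNReal.le_of_forall_pos_le_add fun ε hε _ => ?_
  rw [← ENNReal.coe_add]
  refine localLip_le_of_eventually_ae_lt hK hae ?_
  filter_upwards [hψ x (ψ x + ε) (lt_add_of_pos_right _ hε)] with y hy hyZ
  exact (not_not.1 hyZ).trans_lt (by exact_mod_cast hy)
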